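/- Let $\theta>0$ and $\psi\in\left(0,\frac{\pi}{2}\right]$, and let $$\mathcal{S}_\psi:=\{z\in\mathbb{C}\setminus\{0\}\colon |\arg z|<\psi \text{ and } |\arg(z-\theta)|>\psi\},$$ where $\arg$ is the principal argument (and the point $z=\theta$ is not in $\mathcal{S}_\psi$). Let $w$ be the real-valued harmonic function on $\mathcal{S}_\psi$ which is bounded and continuous on $\overline{\mathcal{S}}_\psi$ and takes the value $0$ on the left boundary half-lines $\{r\mathrm{e}^{\pm\mathrm{i}\psi}\colon r\ge 0\}$ and the value $1$ on the right boundary half-lines $\{\theta+r\mathrm{e}^{\pm\mathrm{i}\psi}\colon r\ge 0\}$. Then $$w(t)\ge \frac{2}{\pi}\left(\frac{\psi}{\sin\psi}\right)^{\frac{\pi}{2\psi}}\left(\frac{t}{\theta}\right)^{\frac{\pi}{2\psi}},\qquad 0<t\le\theta.$$ -/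

import Mathlib

/-- The strip `S_ψ`: points `z ≠ 0` with `|arg z| < ψ` and `|arg (z - θ)| > ψ`, where `arg` is the
principal argument. The vertex `z = θ` is left out, because `Complex.arg 0 = 0`. -/
def sectorStrip (θ ψ : ℝ) : Set ℂ :=
  {z : ℂ | z ≠ 0 ∧ |Complex.arg z| < ψ ∧ ψ < |Complex.arg (z - (θ : ℂ))|}

/-- The union of the two closed half-lines that start at `v` with directions `exp (± i ψ)`. -/
def boundaryHalfLines (v : ℂ) (ψ : ℝ) : Set ℂ :=
  {z : ℂ | ∃ r : ℝ, 0 ≤ r ∧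
    (z = v + (r : ℂ) * Complex.exp ((ψ : ℂ) * Complex.I) ∨
      z = v + (r : ℂ) * Complex.exp (-((ψ : ℂ) * Complex.I)))}

/-- `w` is the harmonic function on the strip, bounded and continuous on its closure, with value
`0` on the left boundary half-lines and value `1` on the right ones. (Values of `w` outside
the closure of the strip play no role.) -/
structure IsStripHarmonicFunction (θ ψ : ℝ) (w : ℂ → ℝ) : Prop where
  harmonic : InnerProductSpace.HarmonicOnNhd w (sectorStrip θ ψ)
  continuousOn : ContinuousOn w (closure (sectorStrip θ ψ))
  bounded : ∃ C : ℝ, ∀ z ∈ closure (sectorStrip θ ψ), |w z| ≤ C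
  left_eq_zero : ∀ z ∈ boundaryHalfLines 0 ψ, w z = 0
  right_eq_one : ∀ z ∈ boundaryHalfLines (θ : ℂ) ψ, w z = 1

/-! Put a = 2ψ/π, so that 0 < a ≤ 1. The proof transports `w` to the straight strip 0 < Re z < π/2
by the Schwarz–Christoffel type map g(z) = (2θ sin ψ/π) ∫₀^z tan^(a-1), called `sectorMap`. It sends
the open strip into `sectorStrip θ ψ` and the edges Re z = 0 and Re z = π/2 into the left and right
boundary half-lines (`sectorMap_mem`, `sectorMap_left`, `sectorMap_right`). Then w ∘ g - (2/π) Re z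
is bounded, harmonic, and zero on both edges, so the minimum principle `nonneg_on_strip` makes it
nonnegative. Only this inequality is needed, so g need not be shown injective or onto.

For 0 < t ≤ θ the intermediate value theorem gives x in [0, π/2] with g(x) = t, hence w(t) ≥ (2/π)
x. Since tan x ≥ x and a - 1 ≤ 0, the integral is at most x^a/a (`stripMap_re_le`), so t ≤ (θ sin
ψ/ψ) x^a. Solving for x gives the bound.

Most of the work is the construction of g up to both edges. The scale factor is correct because the
integral E of tan^(a-1) over (0, π/2) satisfies E sin ψ = π/2 (`tanPrimEnd_re_mul_sin`). That the
image lies between the half-lines follows from monotonicity of a linear form along horizontal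
segments (`lineForm_stripMap_mem`). -/

open Filter Topology
open scoped ComplexConjugate

/-! ### Minimum principle and analytic pullback of harmonic functions. -/

/-- If `h` has a nonnegative value at each point of a compact set where it is not locally the real
part of an analytic function, then `h` is nonnegative on the whole set. -/
theorem nonneg_of_isCompact_of_eventually_eq_re {K : Set ℂ} (hK : IsCompact K) {h : ℂ → ℝ}
    (hc : ContinuousOn h K)
    (hh : ∀ z ∈ K, 0 ≤ h z ∨ (K ∈ 𝓝 z ∧
      ∃ F : ℂ → ℂ, AnalyticAt ℂ F z ∧ ∀ᶠ y in 𝓝 z, h y = (F y).re)) :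
    ∀ z ∈ K, 0 ≤ h z := by
  by_contra! hcon
  obtain ⟨z₁, hz₁, hneg⟩ := hcon
  obtain ⟨m, hm, hmin⟩ := hK.exists_isMinOn ⟨z₁, hz₁⟩ hc
  have hm0 : h m < 0 := lt_of_le_of_lt (hmin hz₁) hneg
  have hMc : IsCompact (K ∩ h ⁻¹' {h m}) :=
    hK.of_isClosed_subset (hc.preimage_isClosed_of_isClosed hK.isClosed isClosed_singleton)
      Set.inter_subset_left
  -- Among the minimisers, one with the largest real part: local constancy will produce another
  -- minimiser further to the right.
  obtain ⟨z, ⟨hzK, hzm⟩, hzmax⟩ := hMc.exists_isMaxOn ⟨m, hm, rfl⟩ Complex.continuous_re.continuousOn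
  have hzm' : h z = h m := hzm
  rcases hh z hzK with h0 | ⟨hn, F, hF, hFe⟩
  · linarith
  -- The norm of exp(-F) is exp(-h) near z, so the maximum modulus principle applies.
  have hmax : IsLocalMax (norm ∘ fun y => Complex.exp (-F y)) z := by
    filter_upwards [hn, hFe] with y hy hy2
    have h1 : h m ≤ h y := hmin hy
    have h3 := hFe.self_of_nhds
    simp only [Function.comp, Complex.norm_exp, Complex.neg_re, Real.exp_le_exp]
    linarith
  have hd : ∀ᶠ y in 𝓝 z, DifferentiableAt ℂ (fun y => Complex.exp (-F y)) y :=
    hF.eventually_analyticAt.mono fun y hy => hy.differentiableAt.neg.cexp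
  have hconst := Complex.eventually_eq_of_isLocalMax_norm hd hmax
  have hev : ∀ᶠ y in 𝓝 z, y ∈ K ∧ h y = h m := by
    filter_upwards [hn, hFe, hconst] with y hy hy2 hy3
    refine ⟨hy, ?_⟩
    have h4 := congrArg norm hy3
    simp only [Complex.norm_exp, Complex.neg_re, Real.exp_eq_exp, neg_inj] at h4
    rw [hy2, h4, ← hFe.self_of_nhds, hzm']
  have hcont : Tendsto (fun t : ℝ => z + (t : ℂ)) (𝓝[>] 0) (𝓝 z) := by
    have : Continuous (fun t : ℝ => z + (t : ℂ)) := by fun_prop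
    have h2 := this.tendsto 0
    simp only [Complex.ofReal_zero, add_zero] at h2
    exact h2.mono_left nhdsWithin_le_nhds
  obtain ⟨t, ht, ht0⟩ := ((hcont.eventually hev).and self_mem_nhdsWithin).exists
  have := hzmax (a := z + t) ⟨ht.1, ht.2⟩
  simp at this
  exact absurd ht0 (not_lt.mpr this)

/-- Minimum principle in a vertical strip for bounded functions. -/
theorem nonneg_on_strip {h : ℂ → ℝ} {b : ℝ}
    (hc : ContinuousOn h {z | 0 ≤ z.re ∧ z.re ≤ b}) {C : ℝ}
    (hC : ∀ z : ℂ, 0 ≤ z.re → z.re ≤ b → |h z| ≤ C)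
    (hl : ∀ z : ℂ, z.re = 0 → 0 ≤ h z) (hr : ∀ z : ℂ, z.re = b → 0 ≤ h z)
    (hh : ∀ z : ℂ, 0 < z.re → z.re < b →
      ∃ F : ℂ → ℂ, AnalyticAt ℂ F z ∧ ∀ᶠ y in 𝓝 z, h y = (F y).re)
    {z : ℂ} (h0 : 0 ≤ z.re) (hb : z.re ≤ b) : 0 ≤ h z := by
  -- Phragmén–Lindelöf barrier: Re(b² - z²) = b² - x² + y² is harmonic, nonnegative on the strip,
  -- and unbounded as |y| grows. It dominates -h on the horizontal sides of a tall rectangle, and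
  -- then ε tends to 0.
  have key : ∀ ε : ℝ, 0 < ε → 0 ≤ h z + ε * (((b : ℂ) ^ 2 - z ^ 2).re) := by
    intro ε hε
    have hB : ∀ y : ℂ, ((b : ℂ) ^ 2 - y ^ 2).re = b ^ 2 - y.re ^ 2 + y.im ^ 2 := by
      intro y
      simp [pow_two]
      ring
    obtain ⟨R, hR1, hR2⟩ : ∃ R : ℝ, |z.im| < R ∧ C ≤ ε * R ^ 2 := by
      have hd : 0 ≤ |C| / ε := by positivity
      refine ⟨|z.im| + 1 + |C| / ε, by linarith, ?_⟩
      have h1 : |C| / ε ≤ (|z.im| + 1 + |C| / ε) ^ 2 := by nlinarith [abs_nonneg z.im]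
      calc C ≤ |C| := le_abs_self C
        _ = ε * (|C| / ε) := by field_simp
        _ ≤ _ := by gcongr
    have hK : IsCompact (Set.Icc 0 b ×ℂ Set.Icc (-R) R) := isCompact_Icc.reProdIm isCompact_Icc
    refine nonneg_of_isCompact_of_eventually_eq_re hK
      (h := fun y => h y + ε * (((b : ℂ) ^ 2 - y ^ 2).re)) ?_ ?_ z ?_
    · refine ContinuousOn.add (hc.mono ?_) (Continuous.continuousOn (by fun_prop))
      intro y hy
      exact ⟨hy.1.1, hy.1.2⟩
    · intro y hy
      obtain ⟨⟨hy1, hy2⟩, hy3, hy4⟩ := hy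
      have hbn : 0 ≤ b ^ 2 - y.re ^ 2 := by nlinarith
      by_cases hy : y.re = 0 ∨ y.re = b ∨ y.im = -R ∨ y.im = R
      · left
        simp only [hB]
        have hp : 0 ≤ ε * (b ^ 2 - y.re ^ 2 + y.im ^ 2) := by positivity
        rcases hy with hy | hy | hy
        · linarith [hl y hy]
        · linarith [hr y hy]
        · have h5 : y.im ^ 2 = R ^ 2 := by rcases hy with hy | hy <;> rw [hy]; ring
          have h6 := neg_le_of_abs_le (hC y hy1 hy2)
          have : 0 ≤ ε * (b ^ 2 - y.re ^ 2) := by positivity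
          rw [h5]
          nlinarith
      · push Not at hy
        right
        have y1 := lt_of_le_of_ne hy1 (Ne.symm hy.1)
        have y2 := lt_of_le_of_ne hy2 hy.2.1
        have y3 := lt_of_le_of_ne hy3 (Ne.symm hy.2.2.1)
        have y4 := lt_of_le_of_ne hy4 hy.2.2.2
        constructor
        · have : Set.Ioo 0 b ×ℂ Set.Ioo (-R) R ∈ 𝓝 y :=
            (isOpen_Ioo.reProdIm isOpen_Ioo).mem_nhds ⟨⟨y1, y2⟩, y3, y4⟩
          filter_upwards [this] with x hx
          exact ⟨⟨hx.1.1.le, hx.1.2.le⟩, hx.2.1.le, hx.2.2.le⟩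
        · obtain ⟨F, hF, hFe⟩ := hh y y1 y2
          refine ⟨fun x => F x + ε * ((b : ℂ) ^ 2 - x ^ 2), by fun_prop, ?_⟩
          filter_upwards [hFe] with x hx
          rw [hx, Complex.add_re, Complex.re_ofReal_mul]
    · exact ⟨⟨h0, hb⟩, (abs_lt.mp hR1).1.le, (abs_lt.mp hR1).2.le⟩
  have hlim : Tendsto (fun ε : ℝ => h z + ε * (((b : ℂ) ^ 2 - z ^ 2).re)) (𝓝[>] 0) (𝓝 (h z)) := by
    have : Continuous (fun ε : ℝ => h z + ε * (((b : ℂ) ^ 2 - z ^ 2).re)) := by fun_prop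
    have h2 := this.tendsto 0
    simp only [zero_mul, add_zero] at h2
    exact h2.mono_left nhdsWithin_le_nhds
  exact ge_of_tendsto hlim (by filter_upwards [self_mem_nhdsWithin] with ε hε using key ε hε)

theorem InnerProductSpace.HarmonicOnNhd.exists_analyticAt_comp {f : ℂ → ℝ} {U : Set ℂ}
    (hU : IsOpen U) (hf : InnerProductSpace.HarmonicOnNhd f U) {g : ℂ → ℂ} {z : ℂ}
    (hg : AnalyticAt ℂ g z) (hz : g z ∈ U) :
    ∃ F : ℂ → ℂ, AnalyticAt ℂ F z ∧ ∀ᶠ y in 𝓝 z, f (g y) = (F y).re := by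
  obtain ⟨r, hr, hrU⟩ := Metric.isOpen_iff.mp hU _ hz
  obtain ⟨F, hF, hFe⟩ := InnerProductSpace.HarmonicOnNhd.exists_analyticOnNhd_ball_re_eq
    (f := f) (z := g z) (R := r) (fun x hx => hf x (hrU hx))
  refine ⟨F ∘ g, (hF _ (Metric.mem_ball_self hr)).comp hg, ?_⟩
  filter_upwards [hg.continuousAt (Metric.ball_mem_nhds _ hr)] with y hy
  exact (hFe hy).symm

/-! ### A primitive of s^(a-1)/(1 + s²). -/

theorem hasDerivAt_intervalIntegral_of_continuousOn {F F' : ℂ → ℝ → ℂ} {U : Set ℂ} (hU : IsOpen U)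
    (hF : ContinuousOn (Function.uncurry F) (U ×ˢ Set.Icc 0 1))
    (hF' : ContinuousOn (Function.uncurry F') (U ×ˢ Set.Icc 0 1))
    (hd : ∀ s ∈ U, ∀ v ∈ Set.Icc (0 : ℝ) 1, HasDerivAt (fun s => F s v) (F' s v) s)
    {s : ℂ} (hs : s ∈ U) :
    HasDerivAt (fun s => ∫ v in (0 : ℝ)..1, F s v) (∫ v in (0 : ℝ)..1, F' s v) s := by
  obtain ⟨r, hr, hrU⟩ := Metric.nhds_basis_closedBall.mem_iff.mp (hU.mem_nhds hs)
  have hslice : ∀ {H : ℂ → ℝ → ℂ}, ContinuousOn (Function.uncurry H) (U ×ˢ Set.Icc 0 1) →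
      ∀ x ∈ U, ContinuousOn (H x) (Set.Icc 0 1) := by
    intro H hH x hx
    exact hH.comp (f := fun v => (x, v)) (by fun_prop) (fun v hv => ⟨hx, hv⟩)
  have hIoc : Set.uIoc (0 : ℝ) 1 ⊆ Set.Icc 0 1 := by
    rw [Set.uIoc_of_le zero_le_one]; exact Set.Ioc_subset_Icc_self
  obtain ⟨C, hC⟩ := ((isCompact_closedBall s r).prod (isCompact_Icc (a := (0 : ℝ)) (b := 1))
    ).exists_bound_of_continuousOn (hF'.mono (Set.prod_mono hrU subset_rfl))
  refine (intervalIntegral.hasDerivAt_integral_of_dominated_loc_of_deriv_le (μ := MeasureTheory.volume)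
    (bound := fun _ => C) (Metric.closedBall_mem_nhds s hr) ?_ ?_ ?_ ?_ ?_ ?_).2
  · filter_upwards [hU.mem_nhds hs] with x hx
    exact ((hslice hF x hx).mono hIoc).aestronglyMeasurable measurableSet_uIoc
  · refine ContinuousOn.intervalIntegrable ?_
    rw [Set.uIcc_of_le zero_le_one]
    exact hslice hF s hs
  · exact ((hslice hF' s hs).mono hIoc).aestronglyMeasurable measurableSet_uIoc
  · exact Eventually.of_forall fun v hv x hx => hC (x, v) ⟨hx, hIoc hv⟩
  · simp
  · exact Eventually.of_forall fun v hv x hx => hd x (hrU hx) v (hIoc hv)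

/-- The point lies on the segment from 1 to 1 + s², and the slit plane is star-shaped about 1. -/
theorem one_add_sq_mul_mem_slitPlane {s : ℂ} (hs : 1 + s ^ 2 ∈ Complex.slitPlane) {p : ℝ}
    (h0 : 0 ≤ p) (h1 : p ≤ 1) : 1 + s ^ 2 * (p : ℂ) ∈ Complex.slitPlane := by
  rcases h0.eq_or_lt with rfl | hp
  · simp
  have hre : (1 + s ^ 2 * (p : ℂ)).re = 1 + (s ^ 2).re * p := by
    rw [Complex.add_re, Complex.one_re, mul_comm, Complex.re_ofReal_mul, mul_comm]
  have him : (1 + s ^ 2 * (p : ℂ)).im = (s ^ 2).im * p := by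
    rw [Complex.add_im, Complex.one_im, mul_comm, Complex.im_ofReal_mul, mul_comm, zero_add]
  rw [Complex.mem_slitPlane_iff] at hs ⊢
  rw [hre, him]
  rw [Complex.add_re, Complex.add_im, Complex.one_re, Complex.one_im] at hs
  rcases hs with hs | hs
  · left; nlinarith
  · right
    rw [zero_add] at hs
    exact mul_ne_zero hs hp.ne'

/-- The factor `∫₀¹ dv / (1 + s² v ^ (2 / a))`. -/
noncomputable def primFactor (a : ℝ) (s : ℂ) : ℂ :=
  ∫ v in (0 : ℝ)..1, (1 + s ^ 2 * ((v ^ (2 / a) : ℝ) : ℂ))⁻¹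

/-- The primitive of `s ^ (a - 1) / (1 + s ^ 2)` that vanishes at `0`. -/
noncomputable def powPrim (a : ℝ) (s : ℂ) : ℂ :=
  s ^ (a : ℂ) * ((a : ℂ)⁻¹ * primFactor a s)

theorem rpow_mem_unit {b v : ℝ} (hb : 0 < b) (hv : v ∈ Set.Icc (0 : ℝ) 1) :
    0 ≤ v ^ b ∧ v ^ b ≤ 1 :=
  ⟨Real.rpow_nonneg hv.1 _, Real.rpow_le_one hv.1 hv.2 hb.le⟩

theorem isOpen_setOf_one_add_sq : IsOpen {s : ℂ | 1 + s ^ 2 ∈ Complex.slitPlane} :=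
  Complex.isOpen_slitPlane.preimage (by fun_prop)

/-- The integrand is the v-derivative of v/(1 + s² v^b). For b = 2/a and F = `primFactor a` the
identity reads F + (s/a) F' = 1/(1 + s²). The bound b ≥ 1, that is a ≤ 2, makes v^b differentiable
at v = 0. -/
theorem integral_primFactor_identity {b : ℝ} (hb : 1 ≤ b) {s : ℂ}
    (hs : 1 + s ^ 2 ∈ Complex.slitPlane) :
    ∫ v in (0 : ℝ)..1, ((1 + s ^ 2 * ((v ^ b : ℝ) : ℂ))⁻¹ -
      b * s ^ 2 * ((v ^ b : ℝ) : ℂ) * ((1 + s ^ 2 * ((v ^ b : ℝ) : ℂ))⁻¹) ^ 2) = (1 + s ^ 2)⁻¹ := by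
  have hb0 : 0 < b := by linarith
  have hne : ∀ v ∈ Set.Icc (0 : ℝ) 1, 1 + s ^ 2 * ((v ^ b : ℝ) : ℂ) ≠ 0 := fun v hv =>
    Complex.slitPlane_ne_zero
      (one_add_sq_mul_mem_slitPlane hs (rpow_mem_unit hb0 hv).1 (rpow_mem_unit hb0 hv).2)
  have hcont : Continuous fun v : ℝ => ((v ^ b : ℝ) : ℂ) :=
    Complex.continuous_ofReal.comp (Real.continuous_rpow_const hb0.le)
  have hci : ContinuousOn (fun v : ℝ => (1 + s ^ 2 * ((v ^ b : ℝ) : ℂ))⁻¹) (Set.Icc 0 1) :=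
    ContinuousOn.inv₀ (continuousOn_const.add (continuousOn_const.mul hcont.continuousOn)) hne
  rw [intervalIntegral.integral_eq_sub_of_hasDerivAt
    (f := fun v : ℝ => (v : ℂ) * (1 + s ^ 2 * ((v ^ b : ℝ) : ℂ))⁻¹)]
  · simp [Real.zero_rpow hb0.ne']
  · intro v hv
    rw [Set.uIcc_of_le zero_le_one] at hv
    have h1 : HasDerivAt (fun v : ℝ => ((v ^ b : ℝ) : ℂ)) ((b * v ^ (b - 1) : ℝ) : ℂ) v :=
      (Real.hasDerivAt_rpow_const (Or.inr hb)).ofReal_comp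
    have h2 : HasDerivAt (fun v : ℝ => (v : ℂ)) 1 v := Complex.ofRealCLM.hasDerivAt
    have h3 := h2.mul (((h1.const_mul (s ^ 2)).const_add 1).inv (hne v hv))
    refine h3.congr_deriv ?_
    have h4 : (v : ℂ) * ((v ^ (b - 1) : ℝ) : ℂ) = ((v ^ b : ℝ) : ℂ) := by
      rw [← Complex.ofReal_mul]
      congr 1
      rcases hv.1.eq_or_lt with rfl | hv0
      · rw [zero_mul, Real.zero_rpow hb0.ne']
      · rw [Real.rpow_sub_one hv0.ne']; field_simp
    have := hne v hv
    rw [← h4] at this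
    rw [Pi.inv_apply, ← h4]
    push_cast
    field_simp
    ring
  · refine ContinuousOn.intervalIntegrable ?_
    rw [Set.uIcc_of_le zero_le_one]
    exact hci.sub ((continuousOn_const.mul hcont.continuousOn).mul (hci.pow 2))

theorem hasDerivAt_primFactor {a : ℝ} (ha : 0 < a) {s : ℂ} (hs : 1 + s ^ 2 ∈ Complex.slitPlane) :
    HasDerivAt (primFactor a) (∫ v in (0 : ℝ)..1, -(2 * s * ((v ^ (2 / a) : ℝ) : ℂ)) *
      ((1 + s ^ 2 * ((v ^ (2 / a) : ℝ) : ℂ))⁻¹) ^ 2) s := by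
  have hb0 : 0 < 2 / a := by positivity
  have hne : ∀ s ∈ {s : ℂ | 1 + s ^ 2 ∈ Complex.slitPlane}, ∀ v ∈ Set.Icc (0 : ℝ) 1,
      1 + s ^ 2 * ((v ^ (2 / a) : ℝ) : ℂ) ≠ 0 := fun s hs v hv =>
    Complex.slitPlane_ne_zero
      (one_add_sq_mul_mem_slitPlane hs (rpow_mem_unit hb0 hv).1 (rpow_mem_unit hb0 hv).2)
  have hcont : Continuous fun x : ℂ × ℝ => ((x.2 ^ (2 / a) : ℝ) : ℂ) :=
    Complex.continuous_ofReal.comp ((Real.continuous_rpow_const hb0.le).comp continuous_snd)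
  have hci : ContinuousOn (fun x : ℂ × ℝ => (1 + x.1 ^ 2 * ((x.2 ^ (2 / a) : ℝ) : ℂ))⁻¹)
      ({s : ℂ | 1 + s ^ 2 ∈ Complex.slitPlane} ×ˢ Set.Icc 0 1) :=
    ContinuousOn.inv₀ (by fun_prop) (fun x hx => hne x.1 hx.1 x.2 hx.2)
  refine hasDerivAt_intervalIntegral_of_continuousOn
    (F := fun s v => (1 + s ^ 2 * ((v ^ (2 / a) : ℝ) : ℂ))⁻¹)
    (F' := fun s v => -(2 * s * ((v ^ (2 / a) : ℝ) : ℂ)) *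
      ((1 + s ^ 2 * ((v ^ (2 / a) : ℝ) : ℂ))⁻¹) ^ 2) isOpen_setOf_one_add_sq hci ?_ ?_ hs
  · simp only [Function.uncurry_def]
    fun_prop
  · intro s hs v hv
    have h1 := ((((hasDerivAt_id s).pow 2).mul_const ((v ^ (2 / a) : ℝ) : ℂ)).const_add 1).inv
      (hne s hs v hv)
    refine h1.congr_deriv ?_
    have := hne s hs v hv
    simp
    field_simp

/-- The substitution u = s v^(1/a) in ∫₀^s u^(a-1)/(1 + u²) du explains the form of `powPrim`: the
branch point is confined to the factor s^a. The product rule gives s^(a-1) (F + (s/a) F') with F =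
`primFactor a`. -/
theorem hasDerivAt_powPrim {a : ℝ} (ha : 0 < a) (ha2 : a ≤ 2) {s : ℂ}
    (hs : 1 + s ^ 2 ∈ Complex.slitPlane) (hs' : s ∈ Complex.slitPlane) :
    HasDerivAt (powPrim a) (s ^ ((a : ℂ) - 1) * (1 + s ^ 2)⁻¹) s := by
  have hb : 1 ≤ 2 / a := by rw [le_div_iff₀ ha]; linarith
  have hb0 : 0 < 2 / a := by positivity
  have hs0 := Complex.slitPlane_ne_zero hs'
  have hac : (a : ℂ) ≠ 0 := by exact_mod_cast ha.ne'
  have h1 : HasDerivAt (fun s : ℂ => s ^ (a : ℂ)) (a * s ^ ((a : ℂ) - 1)) s := by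
    simpa using (hasDerivAt_id s).cpow_const (c := (a : ℂ)) hs'
  refine (h1.mul ((hasDerivAt_primFactor ha hs).const_mul ((a : ℂ)⁻¹))).congr_deriv ?_
  have hne : ∀ v ∈ Set.Icc (0 : ℝ) 1, 1 + s ^ 2 * ((v ^ (2 / a) : ℝ) : ℂ) ≠ 0 := fun v hv =>
    Complex.slitPlane_ne_zero
      (one_add_sq_mul_mem_slitPlane hs (rpow_mem_unit hb0 hv).1 (rpow_mem_unit hb0 hv).2)
  have hcont : Continuous fun v : ℝ => ((v ^ (2 / a) : ℝ) : ℂ) :=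
    Complex.continuous_ofReal.comp (Real.continuous_rpow_const hb0.le)
  have hci : ContinuousOn (fun v : ℝ => (1 + s ^ 2 * ((v ^ (2 / a) : ℝ) : ℂ))⁻¹) (Set.Icc 0 1) :=
    ContinuousOn.inv₀ (continuousOn_const.add (continuousOn_const.mul hcont.continuousOn)) hne
  rw [← integral_primFactor_identity hb hs, intervalIntegral.integral_sub]
  · have h5 : s ^ (a : ℂ) = s ^ ((a : ℂ) - 1) * s := by
      rw [Complex.cpow_sub _ _ hs0, Complex.cpow_one]; field_simp
    have h6 : ∫ v in (0 : ℝ)..1, ((2 / a : ℝ) : ℂ) * s ^ 2 * ((v ^ (2 / a) : ℝ) : ℂ) *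
        ((1 + s ^ 2 * ((v ^ (2 / a) : ℝ) : ℂ))⁻¹) ^ 2 =
        -(s / a) * ∫ v in (0 : ℝ)..1, -(2 * s * ((v ^ (2 / a) : ℝ) : ℂ)) *
      ((1 + s ^ 2 * ((v ^ (2 / a) : ℝ) : ℂ))⁻¹) ^ 2 := by
      rw [← intervalIntegral.integral_const_mul]
      refine intervalIntegral.integral_congr fun v _ => ?_
      push_cast
      field_simp
    rw [h6, h5, ← primFactor]
    field_simp
    ring
  · refine ContinuousOn.intervalIntegrable ?_
    rw [Set.uIcc_of_le zero_le_one]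
    exact hci
  · refine ContinuousOn.intervalIntegrable ?_
    rw [Set.uIcc_of_le zero_le_one]
    exact (continuousOn_const.mul hcont.continuousOn).mul (hci.pow 2)

theorem continuousAt_powPrim {a : ℝ} (ha : 0 < a) {s : ℂ}
    (hs : 1 + s ^ 2 ∈ Complex.slitPlane) (hs' : s = 0 ∨ s ∈ Complex.slitPlane) :
    ContinuousAt (powPrim a) s := by
  have h1 : ContinuousAt (fun s : ℂ => s ^ (a : ℂ)) s := by
    rcases hs' with rfl | hs'
    · exact Complex.continuousAt_cpow_const_of_re_pos (Or.inl le_rfl) (by simpa using ha)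
    · exact continuousAt_cpow_const hs'
  exact h1.mul (continuousAt_const.mul (hasDerivAt_primFactor ha hs).continuousAt)

/-! ### Cosine and tangent on the vertical strip. -/

theorem Complex.cos_re_eq (z : ℂ) : (Complex.cos z).re = Real.cos z.re * Real.cosh z.im := by
  rw [Complex.cos_eq]
  simp [← Complex.ofReal_cos, ← Complex.ofReal_cosh, ← Complex.ofReal_sin, ← Complex.ofReal_sinh]

theorem Complex.cos_im_eq (z : ℂ) : (Complex.cos z).im = -(Real.sin z.re * Real.sinh z.im) := by
  rw [Complex.cos_eq]
  simp [← Complex.ofReal_cos, ← Complex.ofReal_cosh, ← Complex.ofReal_sin, ← Complex.ofReal_sinh]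

theorem Complex.sin_re_eq (z : ℂ) : (Complex.sin z).re = Real.sin z.re * Real.cosh z.im := by
  rw [Complex.sin_eq]
  simp [← Complex.ofReal_cos, ← Complex.ofReal_cosh, ← Complex.ofReal_sin, ← Complex.ofReal_sinh]

theorem Complex.sin_im_eq (z : ℂ) : (Complex.sin z).im = Real.cos z.re * Real.sinh z.im := by
  rw [Complex.sin_eq]
  simp [← Complex.ofReal_cos, ← Complex.ofReal_cosh, ← Complex.ofReal_sin, ← Complex.ofReal_sinh]

theorem Complex.tan_re_eq (z : ℂ) :
    (Complex.tan z).re = Real.sin z.re * Real.cos z.re / Complex.normSq (Complex.cos z) := by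
  rw [Complex.tan, Complex.div_re, Complex.sin_re_eq, Complex.sin_im_eq, Complex.cos_re_eq,
    Complex.cos_im_eq, ← add_div]
  congr 1
  linear_combination (Real.sin z.re * Real.cos z.re) * Real.cosh_sq_sub_sinh_sq z.im

theorem Complex.tan_im_eq (z : ℂ) :
    (Complex.tan z).im = Real.sinh z.im * Real.cosh z.im / Complex.normSq (Complex.cos z) := by
  rw [Complex.tan, Complex.div_im, Complex.sin_re_eq, Complex.sin_im_eq, Complex.cos_re_eq,
    Complex.cos_im_eq, ← sub_div]
  congr 1
  linear_combination (Real.sinh z.im * Real.cosh z.im) * Real.sin_sq_add_cos_sq z.re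

theorem cos_re_pos_of_strip {z : ℂ} (h0 : 0 ≤ z.re) (h1 : z.re < Real.pi / 2) :
    0 < (Complex.cos z).re := by
  rw [Complex.cos_re_eq]
  exact mul_pos (Real.cos_pos_of_mem_Ioo ⟨by linarith [Real.pi_pos], h1⟩) (Real.cosh_pos _)

theorem cos_ne_zero_of_strip {z : ℂ} (h0 : 0 ≤ z.re) (h1 : z.re < Real.pi / 2) :
    Complex.cos z ≠ 0 := fun h => by
  have := cos_re_pos_of_strip h0 h1
  simp [h] at this

theorem one_add_tan_sq_eq {z : ℂ} (h : Complex.cos z ≠ 0) :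
    1 + Complex.tan z ^ 2 = (Complex.cos z ^ 2)⁻¹ := by
  rw [Complex.tan]
  field_simp
  rw [add_comm]
  exact Complex.sin_sq_add_cos_sq z

theorem Complex.inv_mem_slitPlane {z : ℂ} (hz : z ∈ Complex.slitPlane) :
    z⁻¹ ∈ Complex.slitPlane := by
  rw [Complex.mem_slitPlane_iff_arg] at hz ⊢
  refine ⟨?_, inv_ne_zero hz.2⟩
  rw [Complex.arg_inv, if_neg hz.1]
  exact fun h => absurd (Complex.neg_pi_lt_arg z) (by linarith)

/-- Here 1 + tan² = 1/cos², and cos z lies in the open right half-plane, so its square avoids the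
nonpositive reals. -/
theorem one_add_tan_sq_mem_slitPlane {z : ℂ} (h0 : 0 ≤ z.re) (h1 : z.re < Real.pi / 2) :
    1 + Complex.tan z ^ 2 ∈ Complex.slitPlane := by
  rw [one_add_tan_sq_eq (cos_ne_zero_of_strip h0 h1)]
  refine Complex.inv_mem_slitPlane ?_
  rw [Complex.mem_slitPlane_iff]
  have h := cos_re_pos_of_strip h0 h1
  by_cases hi : (Complex.cos z).im = 0
  · left
    rw [pow_two, Complex.mul_re, hi]
    nlinarith
  · right
    rw [pow_two, Complex.mul_im]
    have := mul_ne_zero h.ne' hi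
    intro hc
    apply this
    linarith

theorem normSq_cos_pos {z : ℂ} (h0 : 0 ≤ z.re) (h1 : z.re < Real.pi / 2) :
    0 < Complex.normSq (Complex.cos z) :=
  Complex.normSq_pos.mpr (cos_ne_zero_of_strip h0 h1)

theorem tan_re_pos_of_strip {z : ℂ} (h0 : 0 < z.re) (h1 : z.re < Real.pi / 2) :
    0 < (Complex.tan z).re := by
  rw [Complex.tan_re_eq]
  exact div_pos (mul_pos (Real.sin_pos_of_pos_of_lt_pi h0 (by linarith))
    (Real.cos_pos_of_mem_Ioo ⟨by linarith, h1⟩)) (normSq_cos_pos h0.le h1)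

theorem tan_im_pos_of_strip {z : ℂ} (h0 : 0 ≤ z.re) (h1 : z.re < Real.pi / 2) (hz : 0 < z.im) :
    0 < (Complex.tan z).im := by
  rw [Complex.tan_im_eq]
  exact div_pos (mul_pos (Real.sinh_pos_iff.mpr hz) (Real.cosh_pos _)) (normSq_cos_pos h0 h1)

theorem tan_mem_slitPlane {z : ℂ} (h0 : 0 ≤ z.re) (h1 : z.re < Real.pi / 2) (hz : z ≠ 0) :
    Complex.tan z ∈ Complex.slitPlane := by
  rw [Complex.mem_slitPlane_iff]
  rcases h0.eq_or_lt with h | h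
  · right
    have hi : z.im ≠ 0 := fun hi => hz (Complex.ext h.symm hi)
    rw [Complex.tan_im_eq]
    exact div_ne_zero (mul_ne_zero (fun hs => hi (Real.sinh_eq_zero.mp hs)) (Real.cosh_pos _).ne')
      (normSq_cos_pos h0 h1).ne'
  · left
    exact tan_re_pos_of_strip h h1

/-! ### The primitive of tan^(a-1) away from the right edge. -/

/-- The primitive of `tan ^ (a - 1)` that vanishes at `0`. -/
noncomputable def tanPrim (a : ℝ) (z : ℂ) : ℂ := powPrim a (Complex.tan z)

theorem continuousAt_tanPrim {a : ℝ} (ha : 0 < a) {z : ℂ} (h0 : 0 ≤ z.re)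
    (h1 : z.re < Real.pi / 2) : ContinuousAt (tanPrim a) z := by
  refine ContinuousAt.comp (g := powPrim a) (continuousAt_powPrim ha
    (one_add_tan_sq_mem_slitPlane h0 h1) ?_)
    (Complex.hasDerivAt_tan (cos_ne_zero_of_strip h0 h1)).continuousAt
  by_cases hz : z = 0
  · left; simp [hz]
  · exact Or.inr (tan_mem_slitPlane h0 h1 hz)

theorem hasDerivAt_tanPrim {a : ℝ} (ha : 0 < a) (ha2 : a ≤ 2) {z : ℂ} (h0 : 0 ≤ z.re)
    (h1 : z.re < Real.pi / 2) (hz : z ≠ 0) :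
    HasDerivAt (tanPrim a) (Complex.tan z ^ ((a : ℂ) - 1)) z := by
  have hc := cos_ne_zero_of_strip h0 h1
  refine (HasDerivAt.comp z (hasDerivAt_powPrim ha ha2 (one_add_tan_sq_mem_slitPlane h0 h1)
    (tan_mem_slitPlane h0 h1 hz)) (Complex.hasDerivAt_tan hc)).congr_deriv ?_
  rw [one_add_tan_sq_eq hc]
  field_simp

theorem primFactor_conj (a : ℝ) (s : ℂ) : primFactor a (conj s) = conj (primFactor a s) := by
  rw [primFactor, primFactor, intervalIntegral.integral_of_le zero_le_one,
    intervalIntegral.integral_of_le zero_le_one, ← integral_conj]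
  simp

theorem powPrim_conj (a : ℝ) {s : ℂ} (hs : s = 0 ∨ s ∈ Complex.slitPlane) :
    powPrim a (conj s) = conj (powPrim a s) := by
  have h : s.arg ≠ Real.pi := by
    rcases hs with rfl | hs
    · simpa using Real.pi_pos.ne
    · exact (Complex.mem_slitPlane_iff_arg.mp hs).1
  rw [powPrim, powPrim, primFactor_conj, Complex.conj_cpow _ _ h]
  simp

theorem tanPrim_conj (a : ℝ) {z : ℂ} (h0 : 0 ≤ z.re) (h1 : z.re < Real.pi / 2) :
    tanPrim a (conj z) = conj (tanPrim a z) := by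
  rw [tanPrim, Complex.tan_conj, powPrim_conj]
  · rfl
  · by_cases hz : z = 0
    · left; simp [hz]
    · exact Or.inr (tan_mem_slitPlane h0 h1 hz)

theorem tanPrim_zero {a : ℝ} (ha : 0 < a) : tanPrim a 0 = 0 := by
  have : (a : ℂ) ≠ 0 := by exact_mod_cast ha.ne'
  simp [tanPrim, powPrim, this]

theorem primFactor_I_mul {a T : ℝ} (ha : 0 < a) (h0 : 0 ≤ T) (h1 : T < 1) :
    ∃ r : ℝ, 0 ≤ r ∧ primFactor a ((T : ℂ) * Complex.I) = r := by
  refine ⟨∫ v in (0 : ℝ)..1, (1 - T ^ 2 * v ^ (2 / a))⁻¹, ?_, ?_⟩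
  · refine intervalIntegral.integral_nonneg zero_le_one fun v hv => ?_
    have := rpow_mem_unit (b := 2 / a) (by positivity) hv
    rw [inv_nonneg]
    nlinarith
  · rw [primFactor, ← intervalIntegral.integral_ofReal]
    refine intervalIntegral.integral_congr fun v _ => ?_
    push_cast
    rw [mul_pow, Complex.I_sq]
    ring_nf

/-- On the imaginary axis tan(iy) = i tanh y, and the integral factor is real and nonnegative
because tanh y < 1. The direction thus comes only from i^a. -/
theorem tanPrim_mul_I {a y : ℝ} (ha : 0 < a) (hy : 0 ≤ y) :
    ∃ r : ℝ, 0 ≤ r ∧ tanPrim a ((y : ℂ) * Complex.I) =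
      r * Complex.exp (((a * (Real.pi / 2) : ℝ) : ℂ) * Complex.I) := by
  have hT0 : 0 ≤ Real.tanh y := by
    rw [Real.tanh_eq_sinh_div_cosh]
    exact div_nonneg (Real.sinh_nonneg_iff.mpr hy) (Real.cosh_pos _).le
  obtain ⟨r, hr, hr'⟩ := primFactor_I_mul ha hT0 (Real.tanh_lt_one y)
  refine ⟨Real.tanh y ^ a * (a⁻¹ * r), by positivity, ?_⟩
  rw [tanPrim, Complex.tan_mul_I, ← Complex.ofReal_tanh, powPrim, hr']
  rcases hT0.eq_or_lt with h | h
  · have : (a : ℂ) ≠ 0 := by exact_mod_cast ha.ne'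
    simp [← h, this, ha.ne', Real.zero_rpow]
  · have hT : (Real.tanh y : ℂ) ≠ 0 := by exact_mod_cast h.ne'
    have : ((Real.tanh y : ℂ) * Complex.I) ^ (a : ℂ) = ((Real.tanh y ^ a : ℝ) : ℂ) *
        Complex.exp (((a * (Real.pi / 2) : ℝ) : ℂ) * Complex.I) := by
      rw [Complex.cpow_def_of_ne_zero (mul_ne_zero hT Complex.I_ne_zero),
        Complex.log_ofReal_mul h Complex.I_ne_zero, Complex.log_I, Real.rpow_def_of_pos h,
        Complex.ofReal_exp, ← Complex.exp_add]
      congr 1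
      push_cast
      ring
    rw [this]
    push_cast
    ring

/-! ### Extension to the right edge by reflection. -/

/-- The value at `π / 2` of the primitive of `tan ^ (a - 1)`. -/
noncomputable def tanPrimEnd (a : ℝ) : ℂ :=
  tanPrim a ((Real.pi / 4 : ℝ) : ℂ) + tanPrim (2 - a) ((Real.pi / 4 : ℝ) : ℂ)

/-- The primitive of `tan ^ (a - 1)` on the closed strip `0 ≤ re z ≤ π / 2`. -/
noncomputable def stripMap (a : ℝ) (z : ℂ) : ℂ :=
  if z.re < Real.pi / 2 then tanPrim a z
  else tanPrimEnd a - tanPrim (2 - a) (((Real.pi / 2 : ℝ) : ℂ) - z)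

/-- Since tan(π/2 - z) = 1/tan z, reflection replaces the exponent a - 1 by 1 - a = (2 - a) - 1.
This turns the pole of tan at π/2 into the zero at 0, where the primitive is already continuous. -/
theorem hasDerivAt_tanPrim_reflect {a : ℝ} (ha : 0 < a) (ha2 : a < 2) {z : ℂ} (h0 : 0 < z.re)
    (h1 : z.re < Real.pi / 2) :
    HasDerivAt (fun z => tanPrimEnd a - tanPrim (2 - a) (((Real.pi / 2 : ℝ) : ℂ) - z))
      (Complex.tan z ^ ((a : ℂ) - 1)) z := by
  have hre : (((Real.pi / 2 : ℝ) : ℂ) - z).re = Real.pi / 2 - z.re := by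
    rw [Complex.sub_re, Complex.ofReal_re]
  have h := hasDerivAt_tanPrim (a := 2 - a) (z := ((Real.pi / 2 : ℝ) : ℂ) - z) (by linarith)
    (by linarith) (by rw [hre]; linarith) (by rw [hre]; linarith)
    (fun hz => by rw [hz, Complex.zero_re] at hre; linarith)
  refine ((h.comp z ((hasDerivAt_id z).const_sub _)).const_sub (tanPrimEnd a)).congr_deriv ?_
  have harg : (Complex.tan z).arg ≠ Real.pi :=
    (Complex.mem_slitPlane_iff_arg.mp (Or.inl (tan_re_pos_of_strip h0 h1))).1
  push_cast
  rw [Complex.tan_pi_div_two_sub, Complex.inv_cpow _ _ harg, ← Complex.cpow_neg]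
  simp only [mul_neg, mul_one, neg_neg]
  congr 1
  ring

/-- Both sides have the same derivative on the connected open strip and agree at π/4, by the choice
of `tanPrimEnd`. -/
theorem tanPrim_eq_reflect {a : ℝ} (ha : 0 < a) (ha2 : a < 2) {z : ℂ} (h0 : 0 < z.re)
    (h1 : z.re < Real.pi / 2) :
    tanPrim a z = tanPrimEnd a - tanPrim (2 - a) (((Real.pi / 2 : ℝ) : ℂ) - z) := by
  have hd1 : ∀ z ∈ Complex.re ⁻¹' Set.Ioo 0 (Real.pi / 2), HasDerivAt (tanPrim a)
      (Complex.tan z ^ ((a : ℂ) - 1)) z := fun z hz => hasDerivAt_tanPrim ha ha2.le hz.1.le hz.2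
    (fun h => by rw [h] at hz; simp at hz)
  have hd2 : ∀ z ∈ Complex.re ⁻¹' Set.Ioo 0 (Real.pi / 2), _ := fun z hz =>
    hasDerivAt_tanPrim_reflect ha ha2 hz.1 hz.2
  refine IsOpen.eqOn_of_deriv_eq (s := Complex.re ⁻¹' Set.Ioo 0 (Real.pi / 2))
    (g := fun z => tanPrimEnd a - tanPrim (2 - a) (((Real.pi / 2 : ℝ) : ℂ) - z))
    (x := ((Real.pi / 4 : ℝ) : ℂ))
    (isOpen_Ioo.preimage Complex.continuous_re)
    (((convex_Ioo _ _).linear_preimage Complex.reLm).isPreconnected)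
    (fun z hz => (hd1 z hz).differentiableAt.differentiableWithinAt)
    (fun z hz => (hd2 z hz).differentiableAt.differentiableWithinAt)
    (fun z hz => (hd1 z hz).deriv.trans (hd2 z hz).deriv.symm) ?_ ?_ ⟨h0, h1⟩
  · have := Real.pi_pos
    constructor <;> rw [Complex.ofReal_re] <;> linarith
  · rw [tanPrimEnd, ← Complex.ofReal_sub]
    ring_nf

theorem stripMap_eq_reflect {a : ℝ} (ha : 0 < a) (ha2 : a < 2) {z : ℂ} (h0 : 0 < z.re) :
    stripMap a z = tanPrimEnd a - tanPrim (2 - a) (((Real.pi / 2 : ℝ) : ℂ) - z) := by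
  rw [stripMap]
  split_ifs with h
  · exact tanPrim_eq_reflect ha ha2 h0 h
  · rfl

theorem continuousOn_stripMap {a : ℝ} (ha : 0 < a) (ha2 : a < 2) :
    ContinuousOn (stripMap a) {z | 0 ≤ z.re ∧ z.re ≤ Real.pi / 2} := by
  intro z hz
  apply ContinuousAt.continuousWithinAt
  have hpi := Real.pi_pos
  rcases hz.2.eq_or_lt with h | h
  · have hev : ∀ᶠ y : ℂ in 𝓝 z, 0 < y.re :=
      (isOpen_Ioi.preimage Complex.continuous_re).mem_nhds (by
        change 0 < z.re; linarith)
    refine ContinuousAt.congr ?_ (hev.mono fun y hy => (stripMap_eq_reflect ha ha2 hy).symm)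
    refine continuousAt_const.sub (ContinuousAt.comp (g := tanPrim (2 - a)) ?_ (by fun_prop))
    apply continuousAt_tanPrim (by linarith) <;> rw [Complex.sub_re, Complex.ofReal_re] <;> linarith
  · have hev : ∀ᶠ y : ℂ in 𝓝 z, y.re < Real.pi / 2 :=
      (isOpen_Iio.preimage Complex.continuous_re).mem_nhds h
    refine (continuousAt_tanPrim ha hz.1 h).congr (hev.mono fun y hy => ?_)
    rw [stripMap, if_pos hy]

theorem hasDerivAt_stripMap {a : ℝ} (ha : 0 < a) (ha2 : a < 2) {z : ℂ} (h0 : 0 < z.re)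
    (h1 : z.re < Real.pi / 2) :
    HasDerivAt (stripMap a) (Complex.tan z ^ ((a : ℂ) - 1)) z := by
  have hev : ∀ᶠ y : ℂ in 𝓝 z, y.re < Real.pi / 2 :=
    (isOpen_Iio.preimage Complex.continuous_re).mem_nhds h1
  refine (hasDerivAt_tanPrim ha ha2.le h0.le h1 (fun h => by simp [h] at h0)).congr_of_eventuallyEq
    (hev.mono fun y hy => ?_)
  rw [stripMap, if_pos hy]

theorem tanPrimEnd_im (a : ℝ) : (tanPrimEnd a).im = 0 := by
  have hpi := Real.pi_pos
  have h : ∀ b, (tanPrim b ((Real.pi / 4 : ℝ) : ℂ)).im = 0 := by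
    intro b
    rw [← Complex.conj_eq_iff_im, ← tanPrim_conj, Complex.conj_ofReal] <;>
      rw [Complex.ofReal_re] <;> linarith
  rw [tanPrimEnd, Complex.add_im, h, h, add_zero]

theorem stripMap_conj (a : ℝ) {z : ℂ} (h0 : 0 ≤ z.re) (h1 : z.re ≤ Real.pi / 2) :
    stripMap a (conj z) = conj (stripMap a z) := by
  rw [stripMap, stripMap, Complex.conj_re]
  split_ifs with h
  · exact tanPrim_conj a h0 h
  · have hre : (((Real.pi / 2 : ℝ) : ℂ) - z).re = Real.pi / 2 - z.re := by
      rw [Complex.sub_re, Complex.ofReal_re]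
    have hpi := Real.pi_pos
    have := tanPrim_conj (2 - a) (z := ((Real.pi / 2 : ℝ) : ℂ) - z) (by rw [hre]; linarith)
      (by rw [hre]; linarith)
    rw [map_sub, Complex.conj_ofReal] at this
    rw [this, map_sub, Complex.conj_eq_iff_im.mpr (tanPrimEnd_im a)]

theorem stripMap_left {a : ℝ} (ha : 0 < a) {z : ℂ} (hz : z.re = 0) (hi : 0 ≤ z.im) :
    ∃ r : ℝ, 0 ≤ r ∧
      stripMap a z = r * Complex.exp (((a * (Real.pi / 2) : ℝ) : ℂ) * Complex.I) := by
  obtain ⟨r, hr, h⟩ := tanPrim_mul_I ha hi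
  refine ⟨r, hr, ?_⟩
  have hz' : z = (z.im : ℂ) * Complex.I := by apply Complex.ext <;> simp [hz]
  rw [stripMap, if_pos (by rw [hz]; exact Real.pi_div_two_pos), ← h, ← hz']

theorem stripMap_right {a : ℝ} (ha2 : a < 2) {z : ℂ} (hz : z.re = Real.pi / 2) (hi : 0 ≤ z.im) :
    ∃ r : ℝ, 0 ≤ r ∧ stripMap a z =
      tanPrimEnd a + r * Complex.exp (((a * (Real.pi / 2) : ℝ) : ℂ) * Complex.I) := by
  obtain ⟨r, hr, h⟩ := tanPrim_mul_I (a := 2 - a) (by linarith) hi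
  refine ⟨r, hr, ?_⟩
  have hz' : ((Real.pi / 2 : ℝ) : ℂ) - z = conj ((z.im : ℂ) * Complex.I) := by
    apply Complex.ext <;> simp [← hz]
  rw [stripMap, if_neg hz.not_lt, hz', tanPrim_conj _ (by simp)
    (by simpa using Real.pi_div_two_pos), h, map_mul, Complex.conj_ofReal, ← Complex.exp_conj,
    map_mul, Complex.conj_ofReal, Complex.conj_I, sub_eq_add_neg, ← mul_neg]
  -- The conjugate direction differs from exp(iaπ/2) by a half-turn, which cancels the minus sign in
  -- the reflection.
  have : ((2 - a) * (Real.pi / 2) : ℝ) * -Complex.I =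
      ((a * (Real.pi / 2) : ℝ) : ℂ) * Complex.I - Real.pi * Complex.I := by
    push_cast; ring
  rw [this, Complex.exp_sub_pi_mul_I, neg_neg]

/-! ### Normalisation and location of the image. -/

/-- A linear form that vanishes on the line with direction `exp (i ψ)` and is positive on its
left. -/
noncomputable def lineForm (ψ : ℝ) (z : ℂ) : ℝ := z.im * Real.cos ψ - z.re * Real.sin ψ

theorem lineForm_add (ψ : ℝ) (z w : ℂ) : lineForm ψ (z + w) = lineForm ψ z + lineForm ψ w := by
  simp only [lineForm, Complex.add_im, Complex.add_re]; ring

theorem lineForm_ofReal_mul (ψ r : ℝ) (z : ℂ) : lineForm ψ (r * z) = r * lineForm ψ z := by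
  simp only [lineForm, Complex.re_ofReal_mul, Complex.im_ofReal_mul]; ring

theorem lineForm_ray (ψ r : ℝ) : lineForm ψ (r * Complex.exp ((ψ : ℂ) * Complex.I)) = 0 := by
  rw [lineForm_ofReal_mul, lineForm, Complex.exp_ofReal_mul_I_re, Complex.exp_ofReal_mul_I_im]
  ring

theorem lineForm_eq_norm_mul_sin (ψ : ℝ) (z : ℂ) :
    lineForm ψ z = ‖z‖ * Real.sin (z.arg - ψ) := by
  rw [lineForm, Real.sin_sub, ← Complex.norm_mul_sin_arg z, ← Complex.norm_mul_cos_arg z]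
  ring

theorem lineForm_cpow (ψ c : ℝ) (z : ℂ) :
    lineForm ψ (z ^ (c : ℂ)) = ‖z‖ ^ c * Real.sin (z.arg * c - ψ) := by
  rw [lineForm, Complex.cpow_ofReal_re, Complex.cpow_ofReal_im, Real.sin_sub]
  ring

/-- In the upper half-strip arg(tan z) lies in [0, π/2], so (a - 1) arg(tan z) - aπ/2 lies in [-π/2,
-aπ/2], where the sine is negative. -/
theorem lineForm_tan_cpow_neg {a : ℝ} (ha : 0 < a) (ha1 : a ≤ 1) {z : ℂ} (h0 : 0 ≤ z.re)
    (h1 : z.re < Real.pi / 2) (hz : 0 < z.im) :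
    lineForm (a * (Real.pi / 2)) (Complex.tan z ^ ((a : ℂ) - 1)) < 0 := by
  have hc : (a : ℂ) - 1 = ((a - 1 : ℝ) : ℂ) := by push_cast; rfl
  have him := tan_im_pos_of_strip h0 h1 hz
  have hre : 0 ≤ (Complex.tan z).re := by
    rw [Complex.tan_re_eq]
    exact div_nonneg (mul_nonneg (Real.sin_nonneg_of_nonneg_of_le_pi h0 (by linarith [Real.pi_pos]))
      (Real.cos_nonneg_of_mem_Icc ⟨by linarith [Real.pi_pos], h1.le⟩)) (Complex.normSq_nonneg _)
  have hne : Complex.tan z ≠ 0 := fun h => by simp [h] at him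
  have harg0 : 0 ≤ (Complex.tan z).arg := Complex.arg_nonneg_iff.mpr him.le
  have harg1 : (Complex.tan z).arg ≤ Real.pi / 2 := Complex.arg_le_pi_div_two_iff.mpr (Or.inl hre)
  have hpi := Real.pi_pos
  rw [hc, lineForm_cpow]
  refine mul_neg_of_pos_of_neg (Real.rpow_pos_of_pos (norm_pos_iff.mpr hne) _) ?_
  apply Real.sin_neg_of_neg_of_neg_pi_lt
  · have : 0 < a * (Real.pi / 2) := by positivity
    nlinarith
  · nlinarith

theorem tan_cpow_re_pos {a : ℝ} (ha : 0 < a) (ha1 : a ≤ 1) {z : ℂ} (h0 : 0 < z.re)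
    (h1 : z.re < Real.pi / 2) : 0 < (Complex.tan z ^ ((a : ℂ) - 1)).re := by
  have hc : (a : ℂ) - 1 = ((a - 1 : ℝ) : ℂ) := by push_cast; rfl
  have hre := tan_re_pos_of_strip h0 h1
  have hne : Complex.tan z ≠ 0 := fun h => by simp [h] at hre
  have harg := abs_lt.mp (Complex.abs_arg_lt_pi_div_two_iff.mpr (Or.inl hre))
  rw [hc, Complex.cpow_ofReal_re]
  refine mul_pos (Real.rpow_pos_of_pos (norm_pos_iff.mpr hne) _) (Real.cos_pos_of_mem_Ioo ⟨?_, ?_⟩)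
  · nlinarith
  · nlinarith

theorem hasDerivAt_lineForm {f : ℝ → ℂ} {f' : ℂ} {x : ℝ} (hf : HasDerivAt f f' x) (ψ : ℝ) :
    HasDerivAt (fun x => lineForm ψ (f x)) (lineForm ψ f') x :=
  ((Complex.imCLM.hasFDerivAt.comp_hasDerivAt x hf).mul_const _).sub
    ((Complex.reCLM.hasFDerivAt.comp_hasDerivAt x hf).mul_const _)

theorem hasDerivAt_stripMap_horizontal {a : ℝ} (ha : 0 < a) (ha2 : a < 2) {x : ℝ} (y : ℝ)
    (h0 : 0 < x) (h1 : x < Real.pi / 2) :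
    HasDerivAt (fun x : ℝ => stripMap a (x + y * Complex.I))
      (Complex.tan (x + y * Complex.I) ^ ((a : ℂ) - 1)) x := by
  have h := hasDerivAt_stripMap ha ha2 (z := (x : ℂ) + y * Complex.I) (by simpa using h0)
    (by simpa using h1)
  have h2 : HasDerivAt (fun x : ℝ => (x : ℂ) + y * Complex.I) 1 x :=
    Complex.ofRealCLM.hasDerivAt.add_const _
  exact (HasDerivAt.comp x h h2).congr_deriv (mul_one _)

theorem continuousOn_stripMap_horizontal {a : ℝ} (ha : 0 < a) (ha2 : a < 2) (y : ℝ) :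
    ContinuousOn (fun x : ℝ => stripMap a (x + y * Complex.I)) (Set.Icc 0 (Real.pi / 2)) := by
  refine (continuousOn_stripMap ha ha2).comp (f := fun x : ℝ => (x : ℂ) + y * Complex.I)
    (by fun_prop) ?_
  intro x hx
  simpa using hx

theorem continuous_lineForm (ψ : ℝ) : Continuous (lineForm ψ) := by
  unfold lineForm; fun_prop

theorem lineForm_stripMap_zero {a : ℝ} (ha : 0 < a) {y : ℝ} (hy : 0 ≤ y) :
    lineForm (a * (Real.pi / 2)) (stripMap a (((0 : ℝ) : ℂ) + y * Complex.I)) = 0 := by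
  obtain ⟨r, _, h⟩ := stripMap_left ha (z := ((0 : ℝ) : ℂ) + y * Complex.I) (by simp)
    (by simpa using hy)
  rw [h, lineForm_ray]

theorem lineForm_stripMap_pi_div_two {a : ℝ} (ha2 : a < 2) {y : ℝ} (hy : 0 ≤ y) :
    lineForm (a * (Real.pi / 2)) (stripMap a (((Real.pi / 2 : ℝ) : ℂ) + y * Complex.I)) =
      -((tanPrimEnd a).re * Real.sin (a * (Real.pi / 2))) := by
  obtain ⟨r, _, h⟩ := stripMap_right ha2 (z := ((Real.pi / 2 : ℝ) : ℂ) + y * Complex.I) (by simp)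
    (by simpa using hy)
  rw [h, lineForm_add, lineForm_ray, lineForm, tanPrimEnd_im]
  ring

/-- One has tan z - i = -i exp(iz)/cos z, with |exp(iz)| ≤ 1 and |cos z| ≥ sinh(Im z) ≥ Im z. -/
theorem norm_tan_sub_I_le {z : ℂ} (hz : 0 < z.im) : ‖Complex.tan z - Complex.I‖ ≤ 1 / z.im := by
  have hs : z.im ≤ ‖Complex.cos z‖ := by
    have h1 : z.im ≤ Real.sinh z.im := Real.self_le_sinh_iff.mpr hz.le
    have h2 : ‖Complex.cos z‖ ^ 2 = Real.cos z.re ^ 2 + Real.sinh z.im ^ 2 := by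
      rw [← Complex.normSq_eq_norm_sq, Complex.normSq_apply, Complex.cos_re_eq, Complex.cos_im_eq]
      linear_combination (Real.cos z.re) ^ 2 * Real.cosh_sq_sub_sinh_sq z.im +
        Real.sinh z.im ^ 2 * Real.sin_sq_add_cos_sq z.re
    nlinarith [norm_nonneg (Complex.cos z), sq_nonneg (Real.cos z.re)]
  have hc : Complex.cos z ≠ 0 := norm_pos_iff.mp (hz.trans_le hs)
  have h : Complex.tan z - Complex.I = -Complex.I * Complex.exp (z * Complex.I) / Complex.cos z := by
    rw [Complex.tan, Complex.exp_mul_I]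
    field_simp
    linear_combination Complex.sin z * Complex.I_sq
  rw [h, norm_div, norm_mul, norm_neg, Complex.norm_I, one_mul, Complex.norm_exp]
  refine div_le_div₀ zero_le_one ?_ hz hs
  rw [Real.exp_le_one_iff]
  simpa using hz.le

/-- Along a horizontal segment in the upper half-strip the linear form changes by minus the left
side, whatever the height. High up, tan is close to i, so the slope tends to the form's value -1 at
i^(a-1); the segment has length π/2. -/
theorem tanPrimEnd_re_mul_sin {a : ℝ} (ha : 0 < a) (ha1 : a ≤ 1) :
    (tanPrimEnd a).re * Real.sin (a * (Real.pi / 2)) = Real.pi / 2 := by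
  have ha2 : a < 2 := by linarith
  have hpi := Real.pi_div_two_pos
  -- The mean value theorem at height n + 1 replaces a limit of integrals: wherever the intermediate
  -- point lies, tan there tends to i.
  have hmvt : ∀ n : ℕ, ∃ x ∈ Set.Ioo 0 (Real.pi / 2), lineForm (a * (Real.pi / 2))
      (Complex.tan ((x : ℝ) + ((n + 1 : ℝ) : ℂ) * Complex.I) ^ ((a : ℂ) - 1)) =
      -((tanPrimEnd a).re * Real.sin (a * (Real.pi / 2))) / (Real.pi / 2) := by
    intro n
    obtain ⟨x, hx, h⟩ := exists_hasDerivAt_eq_slope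
      (fun x : ℝ => lineForm (a * (Real.pi / 2)) (stripMap a (x + ((n + 1 : ℝ) : ℂ) * Complex.I)))
      _ hpi ((continuous_lineForm _).comp_continuousOn
        (continuousOn_stripMap_horizontal ha ha2 (n + 1)))
      (fun x hx => hasDerivAt_lineForm
        (hasDerivAt_stripMap_horizontal ha ha2 (n + 1) hx.1 hx.2) _)
    refine ⟨x, hx, ?_⟩
    rw [h, lineForm_stripMap_zero ha (by positivity),
      lineForm_stripMap_pi_div_two ha2 (by positivity), sub_zero, sub_zero]
  choose x hx h using hmvt
  have htan : Tendsto (fun n : ℕ => Complex.tan (((x n : ℝ) : ℂ) + ((n + 1 : ℝ) : ℂ) * Complex.I))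
      atTop (𝓝 Complex.I) := by
    rw [tendsto_iff_norm_sub_tendsto_zero]
    refine squeeze_zero (fun _ => norm_nonneg _) (fun n => ?_)
      tendsto_one_div_add_atTop_nhds_zero_nat
    have him : (((x n : ℝ) : ℂ) + ((n + 1 : ℝ) : ℂ) * Complex.I).im = n + 1 := by simp
    have := norm_tan_sub_I_le (z := ((x n : ℝ) : ℂ) + ((n + 1 : ℝ) : ℂ) * Complex.I)
      (by rw [him]; positivity)
    rwa [him] at this
  have hI : Complex.I ∈ Complex.slitPlane := by simp [Complex.mem_slitPlane_iff]
  have hlim := ((continuous_lineForm (a * (Real.pi / 2))).tendsto _).comp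
    ((continuousAt_cpow_const (b := (a : ℂ) - 1) hI).tendsto.comp htan)
  have hval : lineForm (a * (Real.pi / 2)) (Complex.I ^ ((a : ℂ) - 1)) = -1 := by
    have hc : (a : ℂ) - 1 = ((a - 1 : ℝ) : ℂ) := by push_cast; rfl
    rw [hc, lineForm_cpow, Complex.norm_I, Real.one_rpow, Complex.arg_I, one_mul,
      show Real.pi / 2 * (a - 1) - a * (Real.pi / 2) = -(Real.pi / 2) by ring, Real.sin_neg,
      Real.sin_pi_div_two]
  rw [hval] at hlim
  have hconst := tendsto_nhds_unique hlim (tendsto_const_nhds.congr fun n => (h n).symm)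
  rw [eq_div_iff hpi.ne'] at hconst
  linarith

theorem lineForm_stripMap_mem {a : ℝ} (ha : 0 < a) (ha1 : a ≤ 1) {x y : ℝ} (hx0 : 0 < x)
    (hx1 : x < Real.pi / 2) (hy : 0 < y) :
    lineForm (a * (Real.pi / 2)) (stripMap a (x + y * Complex.I)) ∈
      Set.Ioo (-(Real.pi / 2)) 0 := by
  have ha2 : a < 2 := by linarith
  have hpi := Real.pi_div_two_pos
  have hanti : StrictAntiOn
      (fun x : ℝ => lineForm (a * (Real.pi / 2)) (stripMap a (x + y * Complex.I)))
      (Set.Icc 0 (Real.pi / 2)) := by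
    refine strictAntiOn_of_deriv_neg (convex_Icc _ _) ((continuous_lineForm _).comp_continuousOn
        (continuousOn_stripMap_horizontal ha ha2 y)) fun x hx => ?_
    rw [interior_Icc] at hx
    rw [(hasDerivAt_lineForm (hasDerivAt_stripMap_horizontal ha ha2 y hx.1 hx.2) _).deriv]
    exact lineForm_tan_cpow_neg ha ha1 (by simpa using hx.1.le) (by simpa using hx.2)
      (by simpa using hy)
  have h1 := hanti (Set.left_mem_Icc.mpr hpi.le) ⟨hx0.le, hx1.le⟩ hx0
  have h2 := hanti ⟨hx0.le, hx1.le⟩ (Set.right_mem_Icc.mpr hpi.le) hx1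
  simp only at h1 h2
  rw [lineForm_stripMap_zero ha hy.le] at h1
  rw [lineForm_stripMap_pi_div_two ha2 hy.le, tanPrimEnd_re_mul_sin ha ha1] at h2
  exact ⟨h2, h1⟩

/-! ### Upper half-strip and real segment. -/

theorem stripMap_ofReal_im {a x : ℝ} (hx0 : 0 ≤ x) (hx1 : x ≤ Real.pi / 2) :
    (stripMap a x).im = 0 := by
  rw [← Complex.conj_eq_iff_im, ← stripMap_conj _ (by simpa using hx0) (by simpa using hx1),
    Complex.conj_ofReal]

/-- The map is real on the real segment, and the vertical derivative of its imaginary part is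
Re(tan^(a-1)) > 0. -/
theorem stripMap_im_pos {a : ℝ} (ha : 0 < a) (ha1 : a ≤ 1) {x y : ℝ} (hx0 : 0 < x)
    (hx1 : x < Real.pi / 2) (hy : 0 < y) : 0 < (stripMap a (x + y * Complex.I)).im := by
  have hd : ∀ y : ℝ, HasDerivAt (fun y : ℝ => (stripMap a (x + y * Complex.I)).im)
      (Complex.tan (x + y * Complex.I) ^ ((a : ℂ) - 1)).re y := by
    intro y
    have h := hasDerivAt_stripMap ha (by linarith) (z := (x : ℂ) + y * Complex.I)
      (by simpa using hx0) (by simpa using hx1)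
    have h2 : HasDerivAt (fun y : ℝ => (x : ℂ) + y * Complex.I) (1 * Complex.I) y :=
      (Complex.ofRealCLM.hasDerivAt.mul_const Complex.I).const_add _
    have h3 := Complex.imCLM.hasFDerivAt.comp_hasDerivAt y (HasDerivAt.comp y h h2)
    exact h3.congr_deriv (by simp)
  have hmono : StrictMono fun y : ℝ => (stripMap a (x + y * Complex.I)).im :=
    strictMono_of_deriv_pos fun y => by
      rw [(hd y).deriv]
      exact tan_cpow_re_pos ha ha1 (by simpa using hx0) (by simpa using hx1)
  have := hmono hy
  simpa [stripMap_ofReal_im hx0.le hx1.le] using this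

theorem stripMap_zero {a : ℝ} (ha : 0 < a) : stripMap a 0 = 0 := by
  rw [stripMap, if_pos (by simpa using Real.pi_div_two_pos), tanPrim_zero ha]

theorem stripMap_pi_div_two {a : ℝ} (ha2 : a < 2) :
    stripMap a ((Real.pi / 2 : ℝ) : ℂ) = tanPrimEnd a := by
  rw [stripMap, Complex.ofReal_re, if_neg (lt_irrefl _), sub_self, tanPrim_zero (by linarith),
    sub_zero]

theorem hasDerivAt_stripMap_re {a x : ℝ} (ha : 0 < a) (ha2 : a < 2) (hx0 : 0 < x)
    (hx1 : x < Real.pi / 2) :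
    HasDerivAt (fun x : ℝ => (stripMap a x).re) (Real.tan x ^ (a - 1)) x := by
  have h := Complex.reCLM.hasFDerivAt.comp_hasDerivAt x
    (hasDerivAt_stripMap_horizontal ha ha2 0 hx0 hx1)
  have ht : 0 ≤ Real.tan x := (Real.tan_pos_of_pos_of_lt_pi_div_two hx0 hx1).le
  have h2 : Complex.tan x ^ ((a : ℂ) - 1) = ((Real.tan x ^ (a - 1) : ℝ) : ℂ) := by
    rw [Complex.ofReal_cpow ht]
    push_cast
    rfl
  simp only [Complex.ofReal_zero, zero_mul, add_zero, h2] at h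
  simpa [Function.comp_def] using h

theorem continuousOn_stripMap_re {a : ℝ} (ha : 0 < a) (ha2 : a < 2) :
    ContinuousOn (fun x : ℝ => (stripMap a x).re) (Set.Icc 0 (Real.pi / 2)) := by
  have := Complex.continuous_re.comp_continuousOn (continuousOn_stripMap_horizontal ha ha2 0)
  simpa [Function.comp_def] using this

theorem strictMonoOn_stripMap_re {a : ℝ} (ha : 0 < a) (ha2 : a < 2) :
    StrictMonoOn (fun x : ℝ => (stripMap a x).re) (Set.Icc 0 (Real.pi / 2)) := by
  refine strictMonoOn_of_deriv_pos (convex_Icc _ _) (continuousOn_stripMap_re ha ha2) fun x hx => ?_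
  rw [interior_Icc] at hx
  rw [(hasDerivAt_stripMap_re ha ha2 hx.1 hx.2).deriv]
  exact Real.rpow_pos_of_pos (Real.tan_pos_of_pos_of_lt_pi_div_two hx.1 hx.2) _

theorem stripMap_re_le {a : ℝ} (ha : 0 < a) (ha1 : a ≤ 1) {x : ℝ}
    (hx : x ∈ Set.Icc 0 (Real.pi / 2)) : (stripMap a x).re ≤ x ^ a / a := by
  have ha2 : a < 2 := by linarith
  have hmono : MonotoneOn (fun x : ℝ => x ^ a / a - (stripMap a x).re)
      (Set.Icc 0 (Real.pi / 2)) := by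
    have hd : ∀ x ∈ Set.Ioo 0 (Real.pi / 2), HasDerivAt
        (fun x : ℝ => x ^ a / a - (stripMap a x).re) (x ^ (a - 1) - Real.tan x ^ (a - 1)) x := by
      intro x hx
      have h1 := (Real.hasDerivAt_rpow_const (p := a) (Or.inl hx.1.ne')).div_const a
      rw [mul_div_cancel_left₀ _ ha.ne'] at h1
      exact h1.sub (hasDerivAt_stripMap_re ha ha2 hx.1 hx.2)
    refine monotoneOn_of_deriv_nonneg (convex_Icc _ _)
      ((((Real.continuous_rpow_const ha.le).div_const a).continuousOn).sub
        (continuousOn_stripMap_re ha ha2)) ?_ ?_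
    · rw [interior_Icc]
      exact fun x hx => (hd x hx).differentiableAt.differentiableWithinAt
    · rw [interior_Icc]
      intro x hx
      rw [(hd x hx).deriv, sub_nonneg]
      exact Real.rpow_le_rpow_of_nonpos hx.1 (Real.le_tan hx.1.le hx.2) (by linarith)
  have := hmono (Set.left_mem_Icc.mpr Real.pi_div_two_pos.le) hx hx.1
  simp only [Complex.ofReal_zero, stripMap_zero ha, Real.zero_rpow ha.ne'] at this
  simp at this
  exact this

/-! ### The map to the sector strip and the comparison. -/

/-- The form equals |z| sin(arg z - ψ), so for Im z ≥ 0 its sign decides on which side of ψ the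
argument lies. Translation by -θ adds θ sin ψ to the form. -/
theorem mem_sectorStrip_of_lineForm {θ ψ : ℝ} (hψ : 0 < ψ) (hψ' : ψ ≤ Real.pi / 2) {z : ℂ}
    (him : 0 ≤ z.im) (h0 : lineForm ψ z < 0) (h1 : -(θ * Real.sin ψ) < lineForm ψ z) :
    z ∈ sectorStrip θ ψ := by
  have hpi := Real.pi_pos
  refine ⟨fun h => by simp [h, lineForm] at h0, ?_, ?_⟩
  · have ha := Complex.arg_nonneg_iff.mpr him
    rw [abs_of_nonneg ha]
    by_contra! hc
    rw [lineForm_eq_norm_mul_sin] at h0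
    have := mul_nonneg (norm_nonneg z) (Real.sin_nonneg_of_nonneg_of_le_pi (x := z.arg - ψ)
      (by linarith) (by linarith [Complex.arg_le_pi z]))
    linarith
  · have him' : 0 ≤ (z - θ).im := by simpa using him
    have h2 : 0 < lineForm ψ (z - θ) := by
      simp only [lineForm, Complex.sub_im, Complex.sub_re, Complex.ofReal_im, Complex.ofReal_re]
        at h1 ⊢
      linarith
    have ha := Complex.arg_nonneg_iff.mpr him'
    rw [abs_of_nonneg ha]
    by_contra! hc
    rw [lineForm_eq_norm_mul_sin] at h2
    have := mul_nonneg (norm_nonneg (z - θ)) (Real.sin_nonneg_of_nonneg_of_le_pi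
      (x := ψ - (z - θ).arg) (by linarith) (by linarith))
    rw [← neg_sub ψ (z - θ).arg, Real.sin_neg] at h2
    linarith

theorem conj_mem_sectorStrip {θ ψ : ℝ} {z : ℂ} (hz : z ∈ sectorStrip θ ψ) :
    conj z ∈ sectorStrip θ ψ := by
  have habs : ∀ w : ℂ, |(conj w).arg| = |w.arg| := by
    intro w
    rw [Complex.arg_conj]
    split_ifs with h
    · rw [h]
    · exact abs_neg _
  refine ⟨by simpa using hz.1, by rw [habs]; exact hz.2.1, ?_⟩
  have : conj z - (θ : ℂ) = conj (z - θ) := by rw [map_sub, Complex.conj_ofReal]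
  rw [this, habs]
  exact hz.2.2

theorem conj_mem_boundaryHalfLines {v ψ : ℝ} {z : ℂ} (hz : z ∈ boundaryHalfLines v ψ) :
    conj z ∈ boundaryHalfLines v ψ := by
  obtain ⟨r, hr, h | h⟩ := hz
  · refine ⟨r, hr, Or.inr ?_⟩
    rw [h]
    simp [← Complex.exp_conj]
  · refine ⟨r, hr, Or.inl ?_⟩
    rw [h]
    simp [← Complex.exp_conj]

/-- The conformal map from the strip `0 < re z < π / 2` onto `sectorStrip θ ψ`. -/
noncomputable def sectorMap (θ ψ : ℝ) (z : ℂ) : ℂ :=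
  ((2 * θ * Real.sin ψ / Real.pi : ℝ) : ℂ) * stripMap (2 * ψ / Real.pi) z

section

variable {θ ψ : ℝ}

theorem exponent_pos (hψ : 0 < ψ) : 0 < 2 * ψ / Real.pi := by have := Real.pi_pos; positivity

theorem exponent_le_one (hψ' : ψ ≤ Real.pi / 2) : 2 * ψ / Real.pi ≤ 1 := by
  rw [div_le_one Real.pi_pos]; linarith

theorem exponent_mul (ψ : ℝ) : 2 * ψ / Real.pi * (Real.pi / 2) = ψ := by
  have := Real.pi_pos.ne'
  field_simp

theorem sin_pos_of_angle (hψ : 0 < ψ) (hψ' : ψ ≤ Real.pi / 2) : 0 < Real.sin ψ :=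
  Real.sin_pos_of_pos_of_lt_pi hψ (by linarith [Real.pi_pos])

theorem sectorMap_scale_pos (hθ : 0 < θ) (hψ : 0 < ψ) (hψ' : ψ ≤ Real.pi / 2) :
    0 < 2 * θ * Real.sin ψ / Real.pi := by
  have := sin_pos_of_angle hψ hψ'
  have := Real.pi_pos
  positivity

theorem sectorMap_scale_mul_end (hψ : 0 < ψ) (hψ' : ψ ≤ Real.pi / 2) :
    ((2 * θ * Real.sin ψ / Real.pi : ℝ) : ℂ) * tanPrimEnd (2 * ψ / Real.pi) = θ := by
  have h := tanPrimEnd_re_mul_sin (exponent_pos hψ) (exponent_le_one hψ')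
  rw [exponent_mul] at h
  have hp := Real.pi_pos.ne'
  apply Complex.ext
  · rw [Complex.re_ofReal_mul, Complex.ofReal_re, div_mul_eq_mul_div, div_eq_iff hp]
    linear_combination 2 * θ * h
  · rw [Complex.im_ofReal_mul, tanPrimEnd_im, mul_zero, Complex.ofReal_im]

theorem sectorMap_conj (θ ψ : ℝ) {z : ℂ} (h0 : 0 ≤ z.re) (h1 : z.re ≤ Real.pi / 2) :
    sectorMap θ ψ (conj z) = conj (sectorMap θ ψ z) := by
  rw [sectorMap, sectorMap, stripMap_conj _ h0 h1, map_mul, Complex.conj_ofReal]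

theorem sectorMap_left (hθ : 0 < θ) (hψ : 0 < ψ) (hψ' : ψ ≤ Real.pi / 2) {z : ℂ}
    (hz : z.re = 0) : sectorMap θ ψ z ∈ boundaryHalfLines 0 ψ := by
  have key : ∀ z : ℂ, z.re = 0 → 0 ≤ z.im → sectorMap θ ψ z ∈ boundaryHalfLines (0 : ℝ) ψ := by
    intro z hz hi
    obtain ⟨r, hr, h⟩ := stripMap_left (exponent_pos hψ) hz hi
    refine ⟨2 * θ * Real.sin ψ / Real.pi * r,
      mul_nonneg (sectorMap_scale_pos hθ hψ hψ').le hr, Or.inl ?_⟩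
    rw [sectorMap, h, exponent_mul, Complex.ofReal_zero, zero_add, Complex.ofReal_mul _ r,
      ← mul_assoc]
  rw [← Complex.ofReal_zero]
  rcases le_total 0 z.im with hi | hi
  · exact key z hz hi
  · rw [← Complex.conj_conj z, sectorMap_conj _ _ (by simp [hz])
      (by simpa [hz] using Real.pi_div_two_pos.le)]
    exact conj_mem_boundaryHalfLines (key _ (by simpa using hz) (by simpa using hi))

theorem sectorMap_right (hθ : 0 < θ) (hψ : 0 < ψ) (hψ' : ψ ≤ Real.pi / 2) {z : ℂ}
    (hz : z.re = Real.pi / 2) : sectorMap θ ψ z ∈ boundaryHalfLines (θ : ℂ) ψ := by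
  have key : ∀ z : ℂ, z.re = Real.pi / 2 → 0 ≤ z.im →
      sectorMap θ ψ z ∈ boundaryHalfLines (θ : ℂ) ψ := by
    intro z hz hi
    obtain ⟨r, hr, h⟩ := stripMap_right (a := 2 * ψ / Real.pi)
      (by linarith [exponent_le_one hψ']) hz hi
    refine ⟨2 * θ * Real.sin ψ / Real.pi * r,
      mul_nonneg (sectorMap_scale_pos hθ hψ hψ').le hr, Or.inl ?_⟩
    rw [sectorMap, h, exponent_mul, mul_add, sectorMap_scale_mul_end hψ hψ', Complex.ofReal_mul _ r,
      ← mul_assoc]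
  rcases le_total 0 z.im with hi | hi
  · exact key z hz hi
  · rw [← Complex.conj_conj z, sectorMap_conj _ _
      (by simpa [hz] using Real.pi_div_two_pos.le) (by simp [hz])]
    exact conj_mem_boundaryHalfLines (key _ (by simpa using hz) (by simpa using hi))

theorem sectorMap_mem (hθ : 0 < θ) (hψ : 0 < ψ) (hψ' : ψ ≤ Real.pi / 2) {z : ℂ}
    (h0 : 0 < z.re) (h1 : z.re < Real.pi / 2) : sectorMap θ ψ z ∈ sectorStrip θ ψ := by
  have ha := exponent_pos hψ
  have ha1 := exponent_le_one hψ'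
  have hK := sectorMap_scale_pos hθ hψ hψ'
  have hsin := sin_pos_of_angle hψ hψ'
  have hend := tanPrimEnd_re_mul_sin ha ha1
  rw [exponent_mul] at hend
  have hKpi : 2 * θ * Real.sin ψ / Real.pi * (Real.pi / 2) = θ * Real.sin ψ := by
    have := Real.pi_pos.ne'
    field_simp
  have key : ∀ z : ℂ, 0 < z.re → z.re < Real.pi / 2 → 0 ≤ z.im →
      sectorMap θ ψ z ∈ sectorStrip θ ψ := by
    intro z h0 h1 hi
    suffices h : 0 ≤ (stripMap (2 * ψ / Real.pi) z).im ∧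
        lineForm ψ (stripMap (2 * ψ / Real.pi) z) ∈ Set.Ioo (-(Real.pi / 2)) 0 by
      refine mem_sectorStrip_of_lineForm hψ hψ' ?_ ?_ ?_
      · rw [sectorMap, Complex.im_ofReal_mul]
        exact mul_nonneg hK.le h.1
      · rw [sectorMap, lineForm_ofReal_mul]
        exact mul_neg_of_pos_of_neg hK h.2.2
      · rw [sectorMap, lineForm_ofReal_mul, ← hKpi, ← mul_neg]
        exact mul_lt_mul_of_pos_left h.2.1 hK
    have hz : z = (z.re : ℂ) + z.im * Complex.I := (Complex.re_add_im z).symm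
    -- On the real segment the form is -sin ψ times the real value, which increases strictly from 0
    -- to `tanPrimEnd`; above it the monotonicity along horizontals applies.
    rcases hi.eq_or_lt with hi | hi
    · rw [← hi, Complex.ofReal_zero, zero_mul, add_zero] at hz
      have him := stripMap_ofReal_im (a := 2 * ψ / Real.pi) h0.le h1.le
      have hmono := strictMonoOn_stripMap_re ha (by linarith)
      have hm1 := hmono (Set.left_mem_Icc.mpr Real.pi_div_two_pos.le) ⟨h0.le, h1.le⟩ h0
      have hm2 := hmono ⟨h0.le, h1.le⟩ (Set.right_mem_Icc.mpr Real.pi_div_two_pos.le) h1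
      simp only [Complex.ofReal_zero, stripMap_zero ha, Complex.zero_re] at hm1
      simp only [stripMap_pi_div_two (show 2 * ψ / Real.pi < 2 by linarith)] at hm2
      rw [hz]
      refine ⟨him.ge, ?_⟩
      rw [lineForm, him, zero_mul, zero_sub]
      constructor
      · rw [← hend]
        exact neg_lt_neg (mul_lt_mul_of_pos_right hm2 hsin)
      · exact neg_neg_of_pos (mul_pos hm1 hsin)
    · have h2 := lineForm_stripMap_mem ha ha1 h0 h1 hi
      have h3 := stripMap_im_pos ha ha1 h0 h1 hi
      rw [exponent_mul, ← hz] at h2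
      rw [← hz] at h3
      exact ⟨h3.le, h2⟩
  rcases le_total 0 z.im with hi | hi
  · exact key z h0 h1 hi
  · rw [← Complex.conj_conj z, sectorMap_conj _ _ (by simpa using h0.le) (by simpa using h1.le)]
    exact conj_mem_sectorStrip (key _ (by simpa using h0) (by simpa using h1) (by simpa using hi))

theorem continuousOn_sectorMap (hψ : 0 < ψ) (hψ' : ψ ≤ Real.pi / 2) :
    ContinuousOn (sectorMap θ ψ) {z | 0 ≤ z.re ∧ z.re ≤ Real.pi / 2} :=
  continuousOn_const.mul (continuousOn_stripMap (exponent_pos hψ)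
    (by linarith [exponent_le_one hψ']))

theorem analyticAt_sectorMap (hψ : 0 < ψ) (hψ' : ψ ≤ Real.pi / 2) {z : ℂ}
    (h0 : 0 < z.re) (h1 : z.re < Real.pi / 2) : AnalyticAt ℂ (sectorMap θ ψ) z := by
  refine DifferentiableOn.analyticAt (s := Complex.re ⁻¹' Set.Ioo 0 (Real.pi / 2)) ?_
    ((isOpen_Ioo.preimage Complex.continuous_re).mem_nhds ⟨h0, h1⟩)
  intro y hy
  exact ((hasDerivAt_stripMap (exponent_pos hψ) (by linarith [exponent_le_one hψ']) hy.1
    hy.2).differentiableAt.const_mul _).differentiableWithinAt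

theorem sectorMap_mem_closure (hθ : 0 < θ) (hψ : 0 < ψ) (hψ' : ψ ≤ Real.pi / 2) {z : ℂ}
    (h0 : 0 ≤ z.re) (h1 : z.re ≤ Real.pi / 2) :
    sectorMap θ ψ z ∈ closure (sectorStrip θ ψ) := by
  refine ContinuousWithinAt.mem_closure (s := Complex.re ⁻¹' Set.Ioo 0 (Real.pi / 2))
    ((continuousOn_sectorMap hψ hψ' z ⟨h0, h1⟩).mono fun y hy => ⟨hy.1.le, hy.2.le⟩) ?_
    fun y hy => sectorMap_mem hθ hψ hψ' hy.1 hy.2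
  rw [Complex.closure_preimage_re, closure_Ioo Real.pi_div_two_pos.ne]
  exact ⟨h0, h1⟩

theorem IsStripHarmonicFunction.le_comp_sectorMap {w : ℂ → ℝ}
    (hw : IsStripHarmonicFunction θ ψ w) (hθ : 0 < θ) (hψ : 0 < ψ) (hψ' : ψ ≤ Real.pi / 2) {z : ℂ}
    (h0 : 0 ≤ z.re) (h1 : z.re ≤ Real.pi / 2) :
    2 / Real.pi * z.re ≤ w (sectorMap θ ψ z) := by
  have hpi := Real.pi_pos
  obtain ⟨C, hC⟩ := hw.bounded
  rw [← sub_nonneg]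
  refine nonneg_on_strip (h := fun z => w (sectorMap θ ψ z) - 2 / Real.pi * z.re)
    (b := Real.pi / 2) (C := C + 1) ?_ ?_ ?_ ?_ ?_ h0 h1
  · refine ContinuousOn.sub (hw.continuousOn.comp (continuousOn_sectorMap hψ hψ')
      fun z hz => sectorMap_mem_closure hθ hψ hψ' hz.1 hz.2) ?_
    exact (continuous_const.mul Complex.continuous_re).continuousOn
  · intro z h0 h1
    refine (abs_sub _ _).trans (add_le_add (hC _ (sectorMap_mem_closure hθ hψ hψ' h0 h1)) ?_)
    rw [abs_of_nonneg (by positivity)]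
    calc 2 / Real.pi * z.re ≤ 2 / Real.pi * (Real.pi / 2) := by gcongr
      _ = 1 := by field_simp
  · intro z hz
    rw [hw.left_eq_zero _ (sectorMap_left hθ hψ hψ' hz), hz, mul_zero, sub_zero]
  · intro z hz
    rw [hw.right_eq_one _ (sectorMap_right hθ hψ hψ' hz), hz]
    have : 2 / Real.pi * (Real.pi / 2) = 1 := by field_simp
    rw [this, sub_self]
  · intro z h0 h1
    -- The open set used is the set of all points where `w` is harmonic, so openness of the sector
    -- strip is not needed.
    obtain ⟨F, hF, hFe⟩ := InnerProductSpace.HarmonicOnNhd.exists_analyticAt_comp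
      (InnerProductSpace.isOpen_setOfPred_harmonicAt w) (fun x hx => hx)
      (analyticAt_sectorMap (θ := θ) hψ hψ' h0 h1)
      (hw.harmonic _ (sectorMap_mem hθ hψ hψ' h0 h1))
    refine ⟨fun y => F y - ((2 / Real.pi : ℝ) : ℂ) * y, by fun_prop, ?_⟩
    filter_upwards [hFe] with y hy
    rw [hy, Complex.sub_re, Complex.re_ofReal_mul]

theorem exists_sectorMap_ofReal_eq (hψ : 0 < ψ) (hψ' : ψ ≤ Real.pi / 2) {t : ℝ}
    (ht : 0 ≤ t) (htθ : t ≤ θ) :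
    ∃ x ∈ Set.Icc 0 (Real.pi / 2), sectorMap θ ψ ((x : ℝ) : ℂ) = t := by
  have ha := exponent_pos hψ
  have ha2 : 2 * ψ / Real.pi < 2 := by linarith [exponent_le_one hψ']
  have hivt := intermediate_value_Icc Real.pi_div_two_pos.le
    (f := fun x : ℝ => (sectorMap θ ψ x).re) (by
      simp only [sectorMap, Complex.re_ofReal_mul]
      exact continuousOn_const.mul (continuousOn_stripMap_re ha ha2))
  have hl : (sectorMap θ ψ ((0 : ℝ) : ℂ)).re = 0 := by
    rw [sectorMap, Complex.ofReal_zero, stripMap_zero ha, mul_zero, Complex.zero_re]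
  have hr : (sectorMap θ ψ ((Real.pi / 2 : ℝ) : ℂ)).re = θ := by
    rw [sectorMap, stripMap_pi_div_two ha2, sectorMap_scale_mul_end hψ hψ', Complex.ofReal_re]
  obtain ⟨x, hx, hxt⟩ := hivt ⟨hl.le.trans ht, htθ.trans hr.ge⟩
  refine ⟨x, hx, Complex.ext hxt ?_⟩
  rw [sectorMap, Complex.im_ofReal_mul, stripMap_ofReal_im hx.1 hx.2, mul_zero, Complex.ofReal_im]

theorem sectorMap_ofReal_re_le (hθ : 0 < θ) (hψ : 0 < ψ) (hψ' : ψ ≤ Real.pi / 2) {x : ℝ}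
    (hx : x ∈ Set.Icc 0 (Real.pi / 2)) :
    (sectorMap θ ψ x).re ≤ θ * Real.sin ψ / ψ * x ^ (2 * ψ / Real.pi) := by
  have hpi := Real.pi_pos
  rw [sectorMap, Complex.re_ofReal_mul]
  calc _ ≤ 2 * θ * Real.sin ψ / Real.pi * (x ^ (2 * ψ / Real.pi) / (2 * ψ / Real.pi)) :=
        mul_le_mul_of_nonneg_left (stripMap_re_le (exponent_pos hψ) (exponent_le_one hψ') hx)
          (sectorMap_scale_pos hθ hψ hψ').le
    _ = _ := by field_simp

end

theorem lemma3p3 (θ ψ : ℝ) (hθ : 0 < θ) (hψ : 0 < ψ) (hψ' : ψ ≤ Real.pi / 2)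
    (w : ℂ → ℝ) (hw : IsStripHarmonicFunction θ ψ w) (t : ℝ) (ht : 0 < t) (htθ : t ≤ θ) :
    2 / Real.pi * (ψ / Real.sin ψ) ^ (Real.pi / (2 * ψ)) * (t / θ) ^ (Real.pi / (2 * ψ))
      ≤ w (t : ℂ) := by
  have hpi := Real.pi_pos
  have hsin := sin_pos_of_angle hψ hψ'
  obtain ⟨x, hx, hxt⟩ := exists_sectorMap_ofReal_eq hψ hψ' ht.le htθ
  have h1 := hw.le_comp_sectorMap hθ hψ hψ' (z := x) hx.1 hx.2
  have h2 := sectorMap_ofReal_re_le hθ hψ hψ' hx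
  rw [hxt, Complex.ofReal_re] at h1 h2
  refine le_trans ?_ h1
  rw [mul_assoc, ← Real.mul_rpow (by positivity) (by positivity)]
  refine mul_le_mul_of_nonneg_left ?_ (by positivity)
  -- This is t ≤ (θ sin ψ/ψ) x^a rearranged; raising it to the power 1/a = π/(2ψ) isolates x.
  have h3 : ψ / Real.sin ψ * (t / θ) ≤ x ^ (2 * ψ / Real.pi) := by
    calc ψ / Real.sin ψ * (t / θ)
        ≤ ψ / Real.sin ψ * ((θ * Real.sin ψ / ψ * x ^ (2 * ψ / Real.pi)) / θ) := by gcongr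
      _ = x ^ (2 * ψ / Real.pi) := by field_simp
  calc (ψ / Real.sin ψ * (t / θ)) ^ (Real.pi / (2 * ψ))
      ≤ (x ^ (2 * ψ / Real.pi)) ^ (Real.pi / (2 * ψ)) :=
        Real.rpow_le_rpow (by positivity) h3 (by positivity)
    _ = x := by
        rw [← Real.rpow_mul hx.1, show 2 * ψ / Real.pi * (Real.pi / (2 * ψ)) = 1 by field_simp,
          Real.rpow_one]
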